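/- Let $k=\mathbb{Q}(\sqrt{-3})$, let $\zeta_3=e^{2\pi i/3}$, and let $\mathfrak{p}$ run over the nonzero prime ideals of the ring of integers of $k$ that do not divide $\langle 3\rangle$, with absolute norm $\mathrm{N}(\mathfrak{p})$. For $\sigma>\frac12$ and $y\in\mathbb{R}$ put, in Case 1 (logarithm), $$\widetilde M_\sigma(y)=\exp\left(-2iy\log(1-3^{-\sigma})\right)\prod_{\mathfrak{p}\nmid\langle3\rangle}\left(\frac{1}{\mathrm{N}(\mathfrak{p})+1}+\frac13\,\frac{\mathrm{N}(\mathfrak{p})}{\mathrm{N}(\mathfrak{p})+1}\sum_{j=0}^{2}\exp\left(-2iy\log\left|1-\frac{\zeta_3^j}{\mathrm{N}(\mathfrak{p})^\sigma}\right|\right)\right),$$ and, in Case 2 (logarithmic derivative), $$\widetilde M_\sigma(y)=\exp\left(-2iy\,\frac{\log 3}{3^\sigma-1}\right)\prod_{\mathfrak{p}\nmid\langle3\rangle}\left(\frac{1}{\mathrm{N}(\mathfrak{p})+1}+\frac13\,\frac{\mathrm{N}(\mathfrak{p})}{\mathrm{N}(\mathfrak{p})+1}\sum_{j=0}^{2}\exp\left(-2iy\,\Re\left(\frac{\zeta_3^j\log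 \mathrm{N}(\mathfrak{p})}{\mathrm{N}(\mathfrak{p})^\sigma-\zeta_3^j}\right)\right)\right).$$ Let $\sigma>\frac12$ and $\delta>0$. In both cases the product converges unconditionally for every $y\in\mathbb{R}$, and there is a constant $C>0$, depending only on $\sigma$ and $\delta$, such that in both cases $$\left|\widetilde M_\sigma(y)\right|\le\exp\left(-C|y|^{\frac1\sigma-\delta}\right)$$ for all real $y$ with $|y|$ sufficiently large (in terms of $\sigma$ and $\delta$). -/

import Mathlib

namespace CubicEuler

open NumberField

/-- The field `k = ℚ(√-3) = ℚ(ζ₃)`. -/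
abbrev EisensteinField : Type := CyclotomicField 3 ℚ

/-- The nonzero prime ideals `𝔭` of the ring of integers of `k` with `𝔭 ∤ ⟨3⟩`. -/
abbrev PrimeNotThree : Type :=
  {𝔭 : IsDedekindDomain.HeightOneSpectrum (𝓞 EisensteinField) //
    ¬ 𝔭.asIdeal ∣ Ideal.span {(3 : 𝓞 EisensteinField)}}

/-- The absolute norm `N(𝔭)`. -/
noncomputable def primeNorm (𝔭 : PrimeNotThree) : ℕ := Ideal.absNorm 𝔭.1.asIdeal

/-- `ζ₃ = exp(2πi/3)`. -/
noncomputable def zeta3 : ℂ := Complex.exp (2 * Real.pi * Complex.I / 3)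

/-- The factor at `𝔭` of the Euler product in Case 1 (the logarithm):
`1/(N+1) + (1/3) (N/(N+1)) ∑_{j=0}^{2} exp(-2iy log|1 - ζ₃^j / N^σ|)`, with `N = N(𝔭)`. -/
noncomputable def factorLog (σ y : ℝ) (𝔭 : PrimeNotThree) : ℂ :=
  1 / ((primeNorm 𝔭 : ℂ) + 1) +
    (1 / 3) * ((primeNorm 𝔭 : ℂ) / ((primeNorm 𝔭 : ℂ) + 1)) *
      ∑ j ∈ Finset.range 3,
        Complex.exp (-2 * Complex.I * y *
          (Real.log ‖1 - zeta3 ^ j / (((primeNorm 𝔭 : ℝ) ^ σ : ℝ) : ℂ)‖ : ℝ))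

/-- The factor at `𝔭` of the Euler product in Case 2 (the logarithmic derivative):
`1/(N+1) + (1/3) (N/(N+1)) ∑_{j=0}^{2} exp(-2iy Re(ζ₃^j log N / (N^σ - ζ₃^j)))`,
with `N = N(𝔭)`. -/
noncomputable def factorLogDeriv (σ y : ℝ) (𝔭 : PrimeNotThree) : ℂ :=
  1 / ((primeNorm 𝔭 : ℂ) + 1) +
    (1 / 3) * ((primeNorm 𝔭 : ℂ) / ((primeNorm 𝔭 : ℂ) + 1)) *
      ∑ j ∈ Finset.range 3,
        Complex.exp (-2 * Complex.I * y *
          ((zeta3 ^ j * (Real.log (primeNorm 𝔭) : ℂ) /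
            ((((primeNorm 𝔭 : ℝ) ^ σ : ℝ) : ℂ) - zeta3 ^ j)).re : ℝ))

/-- `M̃_σ(y)` in Case 1. -/
noncomputable def MtildeLog (σ y : ℝ) : ℂ :=
  Complex.exp (-2 * Complex.I * y * (Real.log (1 - (3 : ℝ) ^ (-σ)) : ℝ)) *
    ∏' 𝔭 : PrimeNotThree, factorLog σ y 𝔭

/-- `M̃_σ(y)` in Case 2. -/
noncomputable def MtildeLogDeriv (σ y : ℝ) : ℂ :=
  Complex.exp (-2 * Complex.I * y * (Real.log 3 / ((3 : ℝ) ^ σ - 1) : ℝ)) *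
    ∏' 𝔭 : PrimeNotThree, factorLogDeriv σ y 𝔭

end CubicEuler

/-!
The Euler factor at `𝔭` is a weighted mean of `1` and of the unit vectors `exp(-2iy a_j)`,
`j = 0, 1, 2`. In both cases the phases `a_j` are `O(log N(𝔭) / N(𝔭)^σ)`, and `a_0 + a_1 + a_2` is
`O(log N(𝔭) / N(𝔭)^(3σ))`, because summing over the cube roots of unity removes the first two terms
of the expansion in `ζ₃^j / N(𝔭)^σ`. Hence the factor is `1 + O_y((log N(𝔭))² / N(𝔭)^(2σ))` and the
product converges absolutely for `σ > 1/2` (`norm_phaseFactor_sub_one_le`,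
`multipliable_phaseFactor`). The properties of the phases that are common to both cases are
collected in `AdmissiblePhases`, so that the rest of the argument is carried out once.

For the decay, every factor has norm at most `1`, while `|a_0 - a_1|` is at least `1 / N(𝔭)^σ`: once
`N(𝔭)^σ` exceeds `2 |y| log N(𝔭)` the unit vectors for `j = 0, 1` are separated, but by no more than
a bounded angle, and the factor is at most `exp(-y² N(𝔭)^(-2σ) / 15)` (`norm_phaseFactor_le_exp`).
Keeping primes with `N(𝔭) ≥ X = |y|^(1/σ + η)`, it remains to bound the tail of `∑ N(𝔭)^(-2σ)`
below by `X^(1 - 2σ - η')`.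

Rational primes `p ≡ 1 mod 3` split in `ℚ(ζ₃)` and provide primes of norm `p`, so this is a
statement on primes in an arithmetic progression that is needed at every large scale `X`, with a
loss of `X^η'` allowed. It follows from the simple pole at `s = 1` of the Dirichlet series of `Λ` on
a residue class (which rests on the nonvanishing of Dirichlet `L`-functions on `Re s = 1`) by
Karamata's method: as `t → 0+`, `t ∑ Λ(n) n^(-1-t) P(n^(-t))` tends to `φ(q)⁻¹ ∫₀¹ P` for every
polynomial `P`, and taking for `P` a minorant of a bump function with positive integral shows that
`∑ log p / p` over the primes of the class in `(X, X^(1+ε))` is at least `1` for all large `X`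
(`exists_primes_sum_log_div_ge`, `exists_primes_sum_rpow_ge`).
-/

namespace CubicEuler

/-! ### Primes in arithmetic progressions by Karamata's method -/

section

open Filter Topology ArithmeticFunction vonMangoldt

/-- A one-sided Weierstrass approximation: a bump supported in `[a, b]` is bounded below by a
polynomial that still has positive integral. -/
theorem exists_polynomial_le_bump {a b : ℝ} (ha : 0 < a) (hab : a < b) (hb : b < 1) :
    ∃ P : Polynomial ℝ, (∀ u ∈ Set.Icc (0 : ℝ) 1, u ∉ Set.Ioo a b → P.eval u ≤ 0) ∧
      (∀ u ∈ Set.Icc (0 : ℝ) 1, P.eval u ≤ 1) ∧ 0 < ∫ u in (0 : ℝ)..1, P.eval u := by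
  set f : ℝ → ℝ := fun u ↦ max 0 ((u - a) * (b - u)) with hf
  have hfc : Continuous f := by fun_prop
  have hf0 (u : ℝ) : 0 ≤ f u := le_max_left _ _
  have hfI : 0 < ∫ u in (0 : ℝ)..1, f u := by
    refine intervalIntegral.integral_pos zero_lt_one hfc.continuousOn (fun u _ ↦ hf0 u)
      ⟨(a + b) / 2, ⟨by linarith, by linarith⟩, lt_max_of_lt_right ?_⟩
    exact mul_pos (by linarith) (by linarith)
  -- lowering `f` by `η` before approximating it within `η` keeps the polynomial below `f`
  set η := (∫ u in (0 : ℝ)..1, f u) / 4 with hη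
  have hη0 : 0 < η := by positivity
  obtain ⟨P, hP⟩ := exists_polynomial_near_of_continuousOn 0 1 (fun u ↦ f u - η)
    (by fun_prop) η hη0
  have hup (u : ℝ) (hu : u ∈ Set.Icc (0 : ℝ) 1) : P.eval u ≤ f u := by
    linarith [(abs_lt.mp (hP u hu)).2]
  refine ⟨P, fun u hu huab ↦ (hup u hu).trans (max_le le_rfl ?_), fun u hu ↦ (hup u hu).trans
    (max_le zero_le_one ?_), ?_⟩
  · rcases le_or_gt u a with h | h
    · exact mul_nonpos_of_nonpos_of_nonneg (by linarith) (by linarith)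
    · have : b ≤ u := not_lt.mp fun h' ↦ huab ⟨h, h'⟩
      exact mul_nonpos_of_nonneg_of_nonpos (by linarith) (by linarith)
  · nlinarith [sq_nonneg ((u - a) - (b - u)), hu.1, hu.2]
  · have h1 : ∫ u in (0 : ℝ)..1, (f u - 2 * η) ≤ ∫ u in (0 : ℝ)..1, P.eval u := by
      refine intervalIntegral.integral_mono_on zero_le_one
        (Continuous.intervalIntegrable (by fun_prop) _ _)
        (P.continuous.intervalIntegrable _ _) fun u hu ↦ ?_
      linarith [(abs_lt.mp (hP u hu)).1]
    rw [intervalIntegral.integral_sub (hfc.intervalIntegrable _ _) (by simp)] at h1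
    simp only [intervalIntegral.integral_const, sub_zero, one_smul] at h1
    linarith

theorem summable_residueClass_div_rpow {q : ℕ} (a : ZMod q) {x : ℝ} (hx : 1 < x) :
    Summable fun n : ℕ ↦ residueClass a n / (n : ℝ) ^ x :=
  LSeries.summable_real_of_abscissaOfAbsConv_lt <|
    (abscissaOfAbsConv_residueClass_le_one a).trans_lt <| mod_cast hx

/-- The Dirichlet series of `Λ` on an invertible residue class mod `q` has residue `1/φ(q)` at `1`. -/
theorem tendsto_mul_tsum_residueClass {q : ℕ} [NeZero q] {a : ZMod q} (ha : IsUnit a) :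
    Tendsto (fun t : ℝ ↦ t * ∑' n : ℕ, residueClass a n / (n : ℝ) ^ (1 + t)) (𝓝[>] 0)
      (𝓝 (q.totient : ℝ)⁻¹) := by
  have H {t : ℝ} (ht : 0 < t) :
      t * ∑' n : ℕ, residueClass a n / (n : ℝ) ^ (1 + t) =
        t * (LFunctionResidueClassAux a ((1 + t : ℝ) : ℂ)).re + (q.totient : ℝ)⁻¹ := by
    have hx : 1 < 1 + t := by linarith
    have : ∑' n : ℕ, residueClass a n / (n : ℝ) ^ (1 + t) =
        (LFunctionResidueClassAux a ((1 + t : ℝ) : ℂ)).re +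
          (q.totient : ℝ)⁻¹ / ((1 + t) - 1) := by
      refine Complex.ofReal_injective ?_
      rw [Complex.ofReal_add, ← LFunctionResidueClassAux_real ha hx,
        eqOn_LFunctionResidueClassAux ha <| Set.mem_ofPred.mpr (Complex.ofReal_re (1 + t) ▸ hx)]
      simp only [Complex.ofReal_tsum, Complex.ofReal_div, Complex.ofReal_cpow (Nat.cast_nonneg _),
        Complex.ofReal_natCast, Complex.ofReal_inv, Complex.ofReal_sub, Complex.ofReal_one,
        sub_add_cancel, LSeries, LSeries.term]
      refine tsum_congr fun n ↦ ?_
      split_ifs with hn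
      · simp only [hn, residueClass_apply_zero, Complex.ofReal_zero, zero_div]
      · rfl
    rw [this, add_sub_cancel_left, mul_add, mul_div_cancel₀ _ ht.ne']
  have hc : ContinuousOn (fun t : ℝ ↦ t * (LFunctionResidueClassAux a ((1 + t : ℝ) : ℂ)).re +
      (q.totient : ℝ)⁻¹) (Set.Ici 0) := by
    refine (continuousOn_id.mul (Complex.continuous_re.comp_continuousOn
      ((continuousOn_LFunctionResidueClassAux a).comp (Continuous.continuousOn (by fun_prop))
        fun t ht ↦ ?_))).add continuousOn_const
    simpa using ht
  have := (hc 0 Set.self_mem_Ici).tendsto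
  simp only [zero_mul, zero_add] at this
  refine (this.mono_left (nhdsWithin_mono _ Set.Ioi_subset_Ici_self)).congr' ?_
  filter_upwards [self_mem_nhdsWithin] with t ht using (H ht).symm

theorem residueClass_div_rpow_mul_pow {q : ℕ} (a : ZMod q) (t : ℝ) (k n : ℕ) :
    residueClass a n / (n : ℝ) ^ (1 + t) * ((n : ℝ) ^ (-t)) ^ k =
      residueClass a n / (n : ℝ) ^ (1 + (k + 1) * t) := by
  rcases n.eq_zero_or_pos with rfl | hn
  · simp
  have hn' : (0 : ℝ) < n := by exact_mod_cast hn
  rw [← Real.rpow_mul_natCast hn'.le, div_mul_eq_mul_div, div_eq_div_iff (by positivity)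
    (by positivity), mul_assoc, ← Real.rpow_add hn']
  congr 2
  ring

/-- Karamata's step: the sum over `n` weighted by the polynomial `P` at `n^(-t)` behaves, as
`t → 0+`, like `∫ u in 0..1, P u`. For the monomial `u^k` it is the Dirichlet series at
`1 + (k + 1) t`, whose residue is divided by `k + 1`. -/
theorem tendsto_mul_tsum_residueClass_mul_eval {q : ℕ} [NeZero q] {a : ZMod q} (ha : IsUnit a)
    (P : Polynomial ℝ) :
    (∀ t : ℝ, 0 < t → Summable fun n : ℕ ↦
      residueClass a n / (n : ℝ) ^ (1 + t) * P.eval ((n : ℝ) ^ (-t))) ∧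
    Tendsto (fun t : ℝ ↦ t * ∑' n : ℕ,
      residueClass a n / (n : ℝ) ^ (1 + t) * P.eval ((n : ℝ) ^ (-t))) (𝓝[>] 0)
      (𝓝 ((q.totient : ℝ)⁻¹ * ∫ u in (0 : ℝ)..1, P.eval u)) := by
  induction P using Polynomial.induction_on' with
  | add P Q hP hQ =>
    have hs (t : ℝ) (ht : 0 < t) := (hP.1 t ht).add (hQ.1 t ht)
    refine ⟨fun t ht ↦ (hs t ht).congr fun n ↦ by rw [Polynomial.eval_add, mul_add], ?_⟩
    simp only [Polynomial.eval_add]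
    rw [intervalIntegral.integral_add (P.continuous.intervalIntegrable _ _)
      (Q.continuous.intervalIntegrable _ _), mul_add]
    refine (hP.2.add hQ.2).congr' ?_
    filter_upwards [self_mem_nhdsWithin] with t ht
    rw [← mul_add, ← (hP.1 t ht).tsum_add (hQ.1 t ht)]
    simp only [mul_add]
  | monomial k c =>
    have hk : (0 : ℝ) < k + 1 := by positivity
    have he (t : ℝ) (n : ℕ) : residueClass a n / (n : ℝ) ^ (1 + t) *
        (Polynomial.monomial k c).eval ((n : ℝ) ^ (-t)) =
          c * (residueClass a n / (n : ℝ) ^ (1 + (k + 1) * t)) := by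
      rw [← residueClass_div_rpow_mul_pow, Polynomial.eval_monomial]
      ring
    simp only [he, tsum_mul_left]
    refine ⟨fun t ht ↦ (summable_residueClass_div_rpow a (by nlinarith)).mul_left c, ?_⟩
    have hlim : Tendsto (fun t : ℝ ↦ (k + 1) * t) (𝓝[>] 0) (𝓝[>] 0) := by
      refine tendsto_nhdsWithin_iff.mpr ⟨?_, ?_⟩
      · exact Tendsto.mono_left (Continuous.tendsto' (by fun_prop) _ _ (by simp))
          nhdsWithin_le_nhds
      · filter_upwards [self_mem_nhdsWithin] with t ht using mul_pos hk ht
    have := (((tendsto_mul_tsum_residueClass ha).comp hlim).const_mul (c / (k + 1)))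
    convert this using 2
    · simp only [Function.comp_apply]
      field_simp
    · simp only [Polynomial.eval_monomial, intervalIntegral.integral_const_mul, integral_pow]
      simp
      ring

/-- Primes of the class `r` in the multiplicative window `b^(-1/t) < p < a^(-1/t)`, for small `t`.
The polynomial minorant shows that the window carries weight at least a constant times `1/t`; the
proper prime powers in it only account for a bounded part. -/
theorem exists_primes_sum_log_div_ge {q : ℕ} [NeZero q] {r : ZMod q} (hr : IsUnit r) {a b : ℝ}
    (ha : 0 < a) (hab : a < b) (hb : b < 1) :
    ∀ᶠ t : ℝ in 𝓝[>] 0, ∃ S : Finset ℕ,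
      (∀ p ∈ S, p.Prime ∧ (p : ZMod q) = r ∧ a < (p : ℝ) ^ (-t) ∧ (p : ℝ) ^ (-t) < b) ∧
      1 ≤ ∑ p ∈ S, Real.log p / p := by
  classical
  obtain ⟨P, hPout, hP1, hPI⟩ := exists_polynomial_le_bump ha hab hb
  obtain ⟨hsum, hlim⟩ := tendsto_mul_tsum_residueClass_mul_eval hr P
  set I := ∫ u in (0 : ℝ)..1, P.eval u
  set B := ∑' n : ℕ, (if n.Prime then 0 else residueClass r n) / (n : ℝ) with hB
  have hφ : 0 < (q.totient : ℝ)⁻¹ := inv_pos.mpr (mod_cast q.totient.pos_of_neZero)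
  have hIφ : 0 < (q.totient : ℝ)⁻¹ * I := mul_pos hφ hPI
  have h1 := hlim.eventually (lt_mem_nhds (half_lt_self hIφ))
  have h2 : ∀ᶠ t : ℝ in 𝓝[>] 0, t * (B + 1) < (q.totient : ℝ)⁻¹ * I / 2 := by
    have h0 : Tendsto (fun t : ℝ ↦ t * (B + 1)) (𝓝[>] 0) (𝓝 0) :=
      Tendsto.mono_left (Continuous.tendsto' (by fun_prop) _ _ (by simp)) nhdsWithin_le_nhds
    exact h0.eventually_lt_const (half_pos hIφ)
  filter_upwards [h1, h2, self_mem_nhdsWithin] with t ht1 ht2 ht0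
  have ht0 : 0 < t := ht0
  have hfin : {p : ℕ | p.Prime ∧ (p : ZMod q) = r ∧ a < (p : ℝ) ^ (-t) ∧
      (p : ℝ) ^ (-t) < b}.Finite := by
    have : Tendsto (fun n : ℕ ↦ (n : ℝ) ^ (-t)) atTop (𝓝 0) :=
      (tendsto_rpow_neg_atTop ht0).comp tendsto_natCast_atTop_atTop
    obtain ⟨M, hM⟩ := eventually_atTop.mp (this.eventually_lt_const ha)
    refine (Set.finite_lt_nat M).subset fun p hp ↦ ?_
    by_contra h
    exact (hM p (not_lt.mp h)).not_gt hp.2.2.1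
  refine ⟨hfin.toFinset, fun p hp ↦ by simpa using hp, ?_⟩
  -- each term is at most its contribution from non-primes plus that of the primes in the window
  have hterm (n : ℕ) : residueClass r n / (n : ℝ) ^ (1 + t) * P.eval ((n : ℝ) ^ (-t)) ≤
      (if n.Prime then 0 else residueClass r n) / (n : ℝ) +
        if n ∈ hfin.toFinset then Real.log n / n else 0 := by
    rcases n.eq_zero_or_pos with rfl | hn
    · simp
    have hn1 : (1 : ℝ) ≤ n := by exact_mod_cast hn
    have hn0 : (0 : ℝ) < n := by linarith
    have hw : 0 ≤ residueClass r n := residueClass_nonneg r n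
    have hu : (n : ℝ) ^ (-t) ∈ Set.Icc (0 : ℝ) 1 :=
      ⟨by positivity, Real.rpow_le_one_of_one_le_of_nonpos hn1 (by linarith)⟩
    have hle : residueClass r n / (n : ℝ) ^ (1 + t) ≤ residueClass r n / n := by
      refine div_le_div_of_nonneg_left hw hn0 ?_
      exact Real.self_le_rpow_of_one_le hn1 (by linarith)
    have hle' : residueClass r n / (n : ℝ) ^ (1 + t) * P.eval ((n : ℝ) ^ (-t)) ≤
        residueClass r n / n :=
      (mul_le_of_le_one_right (by positivity) (hP1 _ hu)).trans hle
    have hlog : 0 ≤ Real.log n / n := div_nonneg (Real.log_nonneg hn1) hn0.le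
    by_cases hp : n.Prime
    · rw [if_pos hp, zero_div, zero_add]
      by_cases hmem : n ∈ hfin.toFinset
      · rw [if_pos hmem]
        refine hle'.trans ?_
        gcongr
        exact (residueClass_le r n).trans_eq (vonMangoldt_apply_prime hp)
      · rw [if_neg hmem]
        by_cases hnr : (n : ZMod q) = r
        · refine mul_nonpos_of_nonneg_of_nonpos (by positivity) (hPout _ hu fun h ↦ hmem ?_)
          simpa using ⟨hp, hnr, h⟩
        · have : residueClass r n = 0 := by simp [residueClass, hnr]
          simp [this]
    · rw [if_neg hp]
      refine hle'.trans (le_add_of_nonneg_right ?_)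
      split_ifs <;> [exact hlog; rfl]
  have hsB := summable_residueClass_non_primes_div r
  have hsF : Summable fun n : ℕ ↦ if n ∈ hfin.toFinset then Real.log n / (n : ℝ) else 0 :=
    summable_of_ne_finset_zero (s := hfin.toFinset) fun n hn ↦ if_neg hn
  have hle := Summable.tsum_le_tsum hterm (hsum t ht0) (hsB.add hsF)
  rw [hsB.tsum_add hsF, tsum_eq_sum (s := hfin.toFinset) fun n hn ↦ if_neg hn] at hle
  rw [Finset.sum_congr rfl fun n hn ↦ if_pos hn] at hle
  have hlt := ht2.trans ht1
  have := lt_of_mul_lt_mul_left hlt ht0.le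
  linarith

/-- A lower bound for the tail of `∑ p^(-s)` over the primes of an invertible residue class, at
every large scale `X` and with the loss of an arbitrarily small power of `X`. -/
theorem exists_primes_sum_rpow_ge {q : ℕ} [NeZero q] {r : ZMod q} (hr : IsUnit r) {s η : ℝ}
    (hs : 1 < s) (hη : 0 < η) :
    ∀ᶠ X : ℝ in atTop, ∃ S : Finset ℕ,
      (∀ p ∈ S, p.Prime ∧ (p : ZMod q) = r ∧ X ≤ (p : ℝ)) ∧
      X ^ (1 - s - η) ≤ ∑ p ∈ S, (p : ℝ) ^ (-s) := by
  -- the window of primes is `X < p < X ^ (1 + ε)`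
  obtain ⟨ε, hε, hεs⟩ : ∃ ε : ℝ, 0 < ε ∧ (1 + ε) * (1 - s - ε) = 1 - s - η := by
    -- the positive root of `ε² + s ε - η = 0`
    refine ⟨(-s + √(s ^ 2 + 4 * η)) / 2, ?_, ?_⟩
    · have : s < √(s ^ 2 + 4 * η) := Real.lt_sqrt_of_sq_lt (by linarith)
      linarith
    · have := Real.sq_sqrt (show 0 ≤ s ^ 2 + 4 * η by positivity)
      nlinarith
  -- with `t = log 2 / log X` this window is `2^(-(1 + ε)) < p^(-t) < 2^(-1)`
  have ha : (2 : ℝ) ^ (-(1 + ε)) < 2 ^ (-1 : ℝ) :=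
    Real.rpow_lt_rpow_of_exponent_lt one_lt_two (by linarith)
  have hb : (2 : ℝ) ^ (-1 : ℝ) < 1 := Real.rpow_lt_one_of_one_lt_of_neg one_lt_two (by norm_num)
  have key := exists_primes_sum_log_div_ge hr (by positivity) ha hb
  have hlim : Tendsto (fun X : ℝ ↦ Real.log 2 / Real.log X) atTop (𝓝[>] 0) := by
    refine tendsto_nhdsWithin_iff.mpr ⟨Real.tendsto_log_atTop.const_div_atTop _, ?_⟩
    filter_upwards [eventually_gt_atTop 1] with X hX
    exact div_pos (Real.log_pos one_lt_two) (Real.log_pos hX)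
  have hlog : ∀ᶠ X : ℝ in atTop, ∀ Z ≥ X, Real.log Z ≤ Z ^ ε := by
    have := (isLittleO_log_rpow_atTop hε).bound one_pos
    obtain ⟨M, hM⟩ := eventually_atTop.mp this
    filter_upwards [eventually_ge_atTop M, eventually_ge_atTop 1] with X hX hX1 Z hZ
    have := hM Z (hX.trans hZ)
    rw [one_mul, Real.norm_eq_abs, Real.norm_of_nonneg (Real.rpow_nonneg (by linarith) _)] at this
    exact (le_abs_self _).trans this
  filter_upwards [hlim.eventually key, hlog, eventually_gt_atTop 1] with X hS hXlog hX1
  obtain ⟨S, hS, hsum⟩ := hS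
  have hX0 : 0 < X := by linarith
  have hlX : 0 < Real.log X := Real.log_pos hX1
  have hl2 : 0 < Real.log 2 := Real.log_pos one_lt_two
  have hwin (p : ℕ) (hp : p ∈ S) : X ≤ p ∧ (p : ℝ) ≤ X ^ (1 + ε) := by
    obtain ⟨hpp, -, h1, h2⟩ := hS p hp
    have hp0 : (0 : ℝ) < p := by exact_mod_cast hpp.pos
    have h1 := Real.log_lt_log (by positivity) h1
    have h2 := Real.log_lt_log (by positivity) h2
    rw [Real.log_rpow two_pos, Real.log_rpow hp0] at h1 h2
    have e : -(Real.log 2 / Real.log X) * Real.log p =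
        -(Real.log 2 * (Real.log p / Real.log X)) := by ring
    rw [e] at h1 h2
    have h1' : Real.log p / Real.log X < 1 + ε := by
      refine lt_of_mul_lt_mul_left ?_ hl2.le
      linarith
    have h2' : 1 < Real.log p / Real.log X := by
      refine lt_of_mul_lt_mul_left ?_ hl2.le
      linarith
    rw [div_lt_iff₀ hlX] at h1'
    rw [lt_div_iff₀ hlX, one_mul] at h2'
    refine ⟨((Real.log_lt_log_iff hX0 hp0).mp h2').le, ?_⟩
    rw [← Real.log_le_log_iff hp0 (by positivity), Real.log_rpow hX0]
    exact h1'.le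
  refine ⟨S, fun p hp ↦ ⟨(hS p hp).1, (hS p hp).2.1, (hwin p hp).1⟩, ?_⟩
  have hterm (p : ℕ) (hp : p ∈ S) :
      X ^ (1 - s - η) * (Real.log p / p) ≤ (p : ℝ) ^ (-s) := by
    obtain ⟨h1, h2⟩ := hwin p hp
    have hp0 : (0 : ℝ) < p := by linarith
    have hlp : Real.log p ≤ (p : ℝ) ^ ε := hXlog p h1
    have hpw : X ^ (1 - s - η) ≤ (p : ℝ) ^ (1 - s - ε) := by
      rw [← hεs, Real.rpow_mul hX0.le]
      exact Real.rpow_le_rpow_of_nonpos hp0 h2 (by linarith)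
    calc X ^ (1 - s - η) * (Real.log p / p)
        ≤ (p : ℝ) ^ (1 - s - ε) * ((p : ℝ) ^ ε / p) := by
          gcongr
      _ = (p : ℝ) ^ (-s) := by
          rw [← Real.rpow_sub_one hp0.ne', ← Real.rpow_add hp0]
          congr 1
          ring
  calc X ^ (1 - s - η) ≤ X ^ (1 - s - η) * ∑ p ∈ S, Real.log p / p :=
        le_mul_of_one_le_right (by positivity) hsum
    _ ≤ ∑ p ∈ S, (p : ℝ) ^ (-s) := by
        rw [Finset.mul_sum]
        exact Finset.sum_le_sum hterm

end

/-! ### Euler factors with given phases -/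

section

open Complex

/-- The common shape of the Euler factors in both cases: a prime of norm `N` with phases `a 0`,
`a 1`, `a 2` contributes `1/(N+1) + (1/3) (N/(N+1)) ∑ j < 3, exp(-2iy a_j)`. -/
noncomputable def phaseFactor (N : ℕ) (y : ℝ) (a : ℕ → ℝ) : ℂ :=
  1 / ((N : ℂ) + 1) + (1 / 3) * ((N : ℂ) / ((N : ℂ) + 1)) *
    ∑ j ∈ Finset.range 3, exp (-2 * I * y * (a j : ℝ))

theorem norm_exp_neg_two_I_mul (y t : ℝ) : ‖exp (-2 * I * y * (t : ℝ))‖ = 1 := by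
  rw [show -2 * I * y * (t : ℂ) = ((-2 * y * t : ℝ) : ℂ) * I by push_cast; ring,
    norm_exp_ofReal_mul_I]

theorem norm_phaseFactor_le (N : ℕ) (y : ℝ) (a : ℕ → ℝ) :
    ‖phaseFactor N y a‖ ≤ 1 / ((N : ℝ) + 1) + (1 / 3) * ((N : ℝ) / ((N : ℝ) + 1)) *
      ‖∑ j ∈ Finset.range 3, exp (-2 * I * y * (a j : ℝ))‖ := by
  have h : ‖(N : ℂ) + 1‖ = (N : ℝ) + 1 := by
    rw [← Nat.cast_add_one, norm_natCast, Nat.cast_add_one]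
  refine (norm_add_le _ _).trans_eq ?_
  rw [norm_mul, norm_mul, norm_div, norm_div, norm_div, h]
  simp

theorem norm_phaseFactor_le_one (N : ℕ) (y : ℝ) (a : ℕ → ℝ) : ‖phaseFactor N y a‖ ≤ 1 := by
  have hs : ‖∑ j ∈ Finset.range 3, exp (-2 * I * y * (a j : ℝ))‖ ≤ 3 := by
    refine (norm_sum_le _ _).trans_eq ?_
    simp only [norm_exp_neg_two_I_mul]
    simp
  have hN : (0 : ℝ) < (N : ℝ) + 1 := by positivity
  calc ‖phaseFactor N y a‖ ≤ _ := norm_phaseFactor_le N y a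
    _ ≤ 1 / ((N : ℝ) + 1) + (1 / 3) * ((N : ℝ) / ((N : ℝ) + 1)) * 3 := by gcongr
    _ = 1 := by field_simp; ring

theorem norm_exp_add_exp (y s t : ℝ) :
    ‖exp (-2 * I * y * (s : ℝ)) + exp (-2 * I * y * (t : ℝ))‖ = 2 * |Real.cos (y * (s - t))| := by
  have h : exp (-2 * I * y * (s : ℝ)) + exp (-2 * I * y * (t : ℝ)) =
      exp (((-y * (s + t) : ℝ) : ℂ) * I) * ((2 * Real.cos (y * (s - t)) : ℝ) : ℂ) := by
    push_cast
    rw [two_cos, mul_add, ← exp_add, ← exp_add, add_comm]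
    congr 2 <;> ring
  rw [h, norm_mul, norm_exp_ofReal_mul_I, one_mul, norm_real, Real.norm_eq_abs, abs_mul, abs_two]

/-- If the phases at `j = 0` and `j = 1` differ by a bounded amount, the corresponding two unit
vectors do not align, and the factor falls below `1` by a quadratic amount in the difference. -/
theorem norm_phaseFactor_le_exp {N : ℕ} (hN : 1 ≤ N) {y : ℝ} {a : ℕ → ℝ}
    (h : |y * (a 0 - a 1)| ≤ 3 / 2) :
    ‖phaseFactor N y a‖ ≤ Real.exp (-(1 / 15) * (y * (a 0 - a 1)) ^ 2) := by
  set θ := y * (a 0 - a 1) with hθ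
  have hcos : |Real.cos θ| ≤ 1 - θ ^ 2 / 5 := by
    have hpi := Real.pi_gt_three
    have hpi2 := Real.pi_lt_d2
    have h0 : 0 ≤ Real.cos θ := Real.cos_nonneg_of_mem_Icc
      ⟨by linarith [neg_le_of_abs_le h], by linarith [le_of_abs_le h]⟩
    rw [abs_of_nonneg h0]
    refine (Real.cos_le_one_sub_mul_cos_sq (by linarith)).trans ?_
    have : (1 : ℝ) / 5 ≤ 2 / Real.pi ^ 2 := by
      rw [div_le_div_iff₀ (by norm_num) (by positivity)]
      nlinarith
    nlinarith [sq_nonneg θ]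
  have hs : ‖∑ j ∈ Finset.range 3, exp (-2 * I * y * (a j : ℝ))‖ ≤ 3 - 2 / 5 * θ ^ 2 := by
    simp only [Finset.sum_range_succ, Finset.sum_range_zero, zero_add]
    refine (norm_add_le _ _).trans ?_
    rw [norm_exp_add_exp, norm_exp_neg_two_I_mul]
    linarith
  have hN1 : (1 : ℝ) ≤ N := by exact_mod_cast hN
  have hN0 : (0 : ℝ) < (N : ℝ) + 1 := by positivity
  have hhalf : (1 : ℝ) / 2 ≤ (N : ℝ) / ((N : ℝ) + 1) := by
    rw [div_le_div_iff₀ two_pos hN0]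
    linarith
  calc ‖phaseFactor N y a‖ ≤ _ := norm_phaseFactor_le N y a
    _ ≤ 1 / ((N : ℝ) + 1) + (1 / 3) * ((N : ℝ) / ((N : ℝ) + 1)) * (3 - 2 / 5 * θ ^ 2) := by gcongr
    _ = 1 - 2 / 15 * θ ^ 2 * ((N : ℝ) / ((N : ℝ) + 1)) := by field_simp; ring
    _ ≤ -(1 / 15) * θ ^ 2 + 1 := by nlinarith [sq_nonneg θ]
    _ ≤ _ := Real.add_one_le_exp _

theorem norm_exp_I_mul_sub_one_sub_le (θ : ℝ) : ‖exp (I * θ) - 1 - I * θ‖ ≤ 3 * θ ^ 2 := by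
  have hn : ‖I * (θ : ℂ)‖ = |θ| := by simp
  rcases le_or_gt |θ| 1 with h | h
  · refine (norm_exp_sub_one_sub_id_le (hn.trans_le h)).trans ?_
    rw [hn, sq_abs]
    nlinarith [sq_nonneg θ]
  · have h1 := Real.norm_exp_I_mul_ofReal_sub_one_le (x := θ)
    rw [Real.norm_eq_abs] at h1
    have := (norm_sub_le (exp (I * θ) - 1) (I * θ)).trans (add_le_add h1 hn.le)
    nlinarith [sq_abs θ]

/-- Expanding the exponentials to first order, the linear terms add up to a multiple of
`a 0 + a 1 + a 2`, so the factor differs from `1` only to second order. -/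
theorem norm_phaseFactor_sub_one_le (N : ℕ) (y : ℝ) {a : ℕ → ℝ} {B : ℝ}
    (ha : ∀ j < 3, |a j| ≤ B) (hsum : |a 0 + a 1 + a 2| ≤ B ^ 2) :
    ‖phaseFactor N y a - 1‖ ≤ (|y| + 12 * y ^ 2) * B ^ 2 := by
  have hN : (N : ℂ) + 1 ≠ 0 := by exact_mod_cast Nat.succ_ne_zero N
  set E : ℕ → ℂ := fun j ↦ exp (I * ((-2 * y * a j : ℝ) : ℂ)) - 1 - I * ((-2 * y * a j : ℝ) : ℂ)
    with hE
  have hEle (j : ℕ) (hj : j < 3) : ‖E j‖ ≤ 12 * y ^ 2 * B ^ 2 := by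
    refine (norm_exp_I_mul_sub_one_sub_le _).trans ?_
    have : a j ^ 2 ≤ B ^ 2 := sq_le_sq.mpr ((ha j hj).trans (le_abs_self B))
    nlinarith [mul_le_mul_of_nonneg_left this (sq_nonneg y)]
  have heq : phaseFactor N y a - 1 = (1 / 3) * ((N : ℂ) / ((N : ℂ) + 1)) *
      (E 0 + E 1 + E 2 + I * ((-2 * y * (a 0 + a 1 + a 2) : ℝ) : ℂ)) := by
    simp only [phaseFactor, hE, Finset.sum_range_succ, Finset.sum_range_zero, zero_add]
    have e (j : ℕ) : exp (-2 * I * y * (a j : ℝ)) = exp (I * ((-2 * y * a j : ℝ) : ℂ)) := by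
      congr 1; push_cast; ring
    rw [e 0, e 1, e 2]
    push_cast
    field_simp
    ring
  have hq : ‖(1 / 3 : ℂ) * ((N : ℂ) / ((N : ℂ) + 1))‖ ≤ 1 / 3 := by
    rw [norm_mul, norm_div (N : ℂ), ← Nat.cast_add_one, norm_natCast, norm_natCast]
    have : (N : ℝ) / ((N + 1 : ℕ) : ℝ) ≤ 1 :=
      div_le_one_of_le₀ (by push_cast; linarith) (by positivity)
    have h3 : ‖(1 / 3 : ℂ)‖ = 1 / 3 := by simp
    rw [h3]
    linarith
  have hI : ‖I * ((-2 * y * (a 0 + a 1 + a 2) : ℝ) : ℂ)‖ ≤ 2 * |y| * B ^ 2 := by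
    rw [norm_mul, norm_I, one_mul, norm_real, Real.norm_eq_abs, abs_mul, abs_mul, abs_neg, abs_two]
    gcongr
  rw [heq, norm_mul]
  calc _ ≤ 1 / 3 * (12 * y ^ 2 * B ^ 2 + 12 * y ^ 2 * B ^ 2 + 12 * y ^ 2 * B ^ 2 +
        2 * |y| * B ^ 2) := by
        gcongr
        refine (norm_add_le _ _).trans (add_le_add ((norm_add₃_le).trans ?_) hI)
        exact add_le_add (add_le_add (hEle 0 (by norm_num)) (hEle 1 (by norm_num)))
          (hEle 2 (by norm_num))
    _ ≤ _ := by nlinarith [mul_nonneg (abs_nonneg y) (sq_nonneg B)]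

end

/-! ### The phases of the logarithm and of the logarithmic derivative -/

section

open Complex

/-- What both cases need from the phases `a 0, a 1, a 2` at a prime, where `L` stands for `log N`
and `x` for `N^(-σ)`. They are `O(L x)` and cancel in the sum to second order, which gives
convergence of the product; and for `L ≥ 1`, `x ≤ 1/2` the absolute value of the difference
`a 0 - a 1` lies between `x` and `3 L x`, which gives the decay. The constants are those that serve
for both cases. -/
structure AdmissiblePhases (a : ℕ → ℝ) (L x : ℝ) : Prop where
  abs_le : ∀ j < 3, |a j| ≤ 8 * L * x
  abs_sum_le : |a 0 + a 1 + a 2| ≤ (8 * L * x) ^ 2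
  le_abs_sub : 1 ≤ L → x ≤ 1 / 2 → x ≤ |a 0 - a 1|
  abs_sub_le : 1 ≤ L → x ≤ 1 / 2 → |a 0 - a 1| ≤ 3 * L * x

theorem zeta3_eq : zeta3 = ⟨-1 / 2, √3 / 2⟩ := by
  have h : zeta3 = exp (((Real.pi - Real.pi / 3 : ℝ) : ℂ) * I) := by
    rw [zeta3]; congr 1; push_cast; ring
  rw [h, exp_mul_I, ← ofReal_cos, ← ofReal_sin, Real.cos_pi_sub, Real.sin_pi_sub,
    Real.cos_pi_div_three, Real.sin_pi_div_three]
  apply Complex.ext <;> simp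
  norm_num

theorem zeta3_sq_eq : zeta3 ^ 2 = ⟨-1 / 2, -(√3 / 2)⟩ := by
  have h3 : √3 * √3 = 3 := Real.mul_self_sqrt (by norm_num)
  rw [zeta3_eq, sq]
  apply Complex.ext
  · simp only [mul_re]; nlinarith
  · simp only [mul_im]; ring

theorem log_norm_one_sub_div {Q : ℝ} {z : ℂ} (hre : z.re = -1 / 2) (him : z.im ^ 2 = 3 / 4) :
    Real.log ‖1 - z / (Q : ℂ)‖ = Real.log (1 + Q⁻¹ + Q⁻¹ ^ 2) / 2 := by
  have h : normSq (1 - z / (Q : ℂ)) = 1 + Q⁻¹ + Q⁻¹ ^ 2 := by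
    rw [div_eq_mul_inv, ← ofReal_inv, normSq_apply]
    simp only [sub_re, sub_im, one_re, one_im, re_mul_ofReal, im_mul_ofReal, hre]
    linear_combination Q⁻¹ ^ 2 * him
  rw [Complex.norm_def, h, Real.log_sqrt (by nlinarith [sq_nonneg (Q⁻¹ + 1 / 2)])]

theorem re_mul_div_sub {Q L : ℝ} {z : ℂ} (hre : z.re = -1 / 2) (him : z.im ^ 2 = 3 / 4) :
    (z * (L : ℂ) / ((Q : ℂ) - z)).re = -(L * (Q / 2 + 1) / (Q ^ 2 + Q + 1)) := by
  have h : normSq ((Q : ℂ) - z) = Q ^ 2 + Q + 1 := by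
    rw [normSq_apply]
    simp only [sub_re, sub_im, ofReal_re, ofReal_im, hre]
    linear_combination him
  rw [div_re, h, re_mul_ofReal, im_mul_ofReal, sub_re, sub_im, ofReal_re, ofReal_im, hre,
    ← add_div, ← neg_div]
  congr 1
  linear_combination -L * him

theorem admissiblePhases_log {Q L : ℝ} (hQ : 4 / 3 ≤ Q) (hL : 1 / 2 ≤ L) :
    AdmissiblePhases (fun j ↦ Real.log ‖1 - zeta3 ^ j / (Q : ℂ)‖) L Q⁻¹ := by
  have h3 : (√3 / 2) ^ 2 = 3 / 4 := by rw [div_pow, Real.sq_sqrt (by norm_num)]; norm_num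
  have h0 : Real.log ‖1 - zeta3 ^ 0 / (Q : ℂ)‖ = Real.log (1 - Q⁻¹) := by
    rw [pow_zero, one_div, ← ofReal_inv, ← ofReal_one, ← ofReal_sub, norm_real, Real.norm_eq_abs,
      Real.log_abs]
  have h1 : Real.log ‖1 - zeta3 ^ 1 / (Q : ℂ)‖ = Real.log (1 + Q⁻¹ + Q⁻¹ ^ 2) / 2 := by
    rw [pow_one]
    exact log_norm_one_sub_div (by rw [zeta3_eq]) (by rw [zeta3_eq]; exact h3)
  have h2 : Real.log ‖1 - zeta3 ^ 2 / (Q : ℂ)‖ = Real.log (1 + Q⁻¹ + Q⁻¹ ^ 2) / 2 :=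
    log_norm_one_sub_div (by rw [zeta3_sq_eq]) (by rw [zeta3_sq_eq, neg_sq]; exact h3)
  have hQ0 : 0 < Q := by linarith
  have hx0 : 0 < Q⁻¹ := by positivity
  have hx1 : Q⁻¹ ≤ 3 / 4 := by
    rw [inv_le_comm₀ hQ0 (by norm_num)]; linarith
  generalize Q⁻¹ = x at *
  set A := Real.log (1 - x) with hA
  set D := Real.log (1 + x + x ^ 2) with hD
  have hAu : A ≤ -x := by
    have := Real.log_le_sub_one_of_pos (show 0 < 1 - x by linarith)
    linarith
  have hinv : (1 - x) * (1 - x)⁻¹ = 1 := mul_inv_cancel₀ (by linarith)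
  have hAl : 1 - (1 - x)⁻¹ ≤ A := Real.one_sub_inv_le_log_of_pos (by linarith)
  have hinv4 : (1 - x)⁻¹ ≤ 4 := by
    rw [inv_le_comm₀ (by linarith) (by norm_num)]; linarith
  have hA4 : -(4 * x) ≤ A := by
    linarith [mul_le_mul_of_nonneg_left hinv4 hx0.le]
  have hD0 : 0 ≤ D := Real.log_nonneg (by nlinarith)
  have hDu : D ≤ x + x ^ 2 := by
    have := Real.log_le_sub_one_of_pos (show 0 < 1 + x + x ^ 2 by positivity)
    linarith
  have hD2 : D ≤ 2 * x := by nlinarith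
  have hLx : 4 * x ≤ 8 * L * x := by nlinarith
  refine ⟨fun j hj ↦ ?_, ?_, fun _ hx ↦ ?_, fun hL1 hx ↦ ?_⟩
  · interval_cases j
    · rw [h0, abs_le]; constructor <;> linarith
    · rw [h1, abs_le]; constructor <;> linarith
    · rw [h2, abs_le]; constructor <;> linarith
  · -- the three logarithms add up to `log (1 - x ^ 3)`
    have hx3 : x ^ 3 ≤ 27 / 64 := by
      calc x ^ 3 ≤ (3 / 4) ^ 3 := by gcongr
        _ = 27 / 64 := by norm_num
    have hsum : A + D / 2 + D / 2 = Real.log (1 - x ^ 3) := by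
      rw [add_assoc, add_halves, hA, hD, ← Real.log_mul (by linarith) (by positivity)]
      congr 1
      ring
    have hu := Real.log_le_sub_one_of_pos (show 0 < 1 - x ^ 3 by linarith)
    have hl : 1 - (1 - x ^ 3)⁻¹ ≤ _ := Real.one_sub_inv_le_log_of_pos (by linarith)
    have hinv3 : (1 - x ^ 3) * (1 - x ^ 3)⁻¹ = 1 := mul_inv_cancel₀ (by linarith)
    have hinv2 : (1 - x ^ 3)⁻¹ ≤ 2 := by
      rw [inv_le_comm₀ (by linarith) (by norm_num)]; linarith
    have hx30 : 0 ≤ x ^ 3 := by positivity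
    have hzi := mul_le_mul_of_nonneg_left hinv2 hx30
    have hbound : 2 * x ^ 3 ≤ (8 * L * x) ^ 2 := by
      calc 2 * x ^ 3 = 2 * x ^ 2 * x := by ring
        _ ≤ 2 * x ^ 2 * (3 / 4) := by gcongr
        _ ≤ (4 * x) ^ 2 := by linarith [sq_nonneg x, mul_pow 4 x 2]
        _ ≤ (8 * L * x) ^ 2 := by gcongr
    rw [h0, h1, h2, hsum, abs_le]
    constructor <;> linarith
  · rw [h0, h1, abs_of_nonpos (by linarith)]
    linarith
  · have hinv2 : (1 - x)⁻¹ ≤ 2 := by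
      rw [inv_le_comm₀ (by linarith) (by norm_num)]; linarith
    have hA2 : -(2 * x) ≤ A := by
      linarith [mul_le_mul_of_nonneg_left hinv2 hx0.le]
    have hL1x : 1 * x ≤ L * x := by gcongr
    have hxx : x ^ 2 ≤ x := by nlinarith
    rw [h0, h1, abs_of_nonpos (by linarith)]
    linarith

theorem admissiblePhases_logDeriv {Q L : ℝ} (hQ : 4 / 3 ≤ Q) (hL : 1 / 2 ≤ L) :
    AdmissiblePhases (fun j ↦ (zeta3 ^ j * (L : ℂ) / ((Q : ℂ) - zeta3 ^ j)).re) L Q⁻¹ := by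
  have h3 : (√3 / 2) ^ 2 = 3 / 4 := by rw [div_pow, Real.sq_sqrt (by norm_num)]; norm_num
  set A := L / (Q - 1) with hA
  set D := L * (Q / 2 + 1) / (Q ^ 2 + Q + 1) with hD
  have h0 : (zeta3 ^ 0 * (L : ℂ) / ((Q : ℂ) - zeta3 ^ 0)).re = A := by
    rw [pow_zero, one_mul, ← ofReal_one, ← ofReal_sub, ← ofReal_div, ofReal_re]
  have h1 : (zeta3 ^ 1 * (L : ℂ) / ((Q : ℂ) - zeta3 ^ 1)).re = -D := by
    rw [pow_one]
    exact re_mul_div_sub (by rw [zeta3_eq]) (by rw [zeta3_eq]; exact h3)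
  have h2 : (zeta3 ^ 2 * (L : ℂ) / ((Q : ℂ) - zeta3 ^ 2)).re = -D :=
    re_mul_div_sub (by rw [zeta3_sq_eq]) (by rw [zeta3_sq_eq, neg_sq]; exact h3)
  have hQ0 : 0 < Q := by linarith
  have hQ1 : 0 < Q - 1 := by linarith
  have hL0 : 0 < L := by linarith
  have hx0 : 0 < L * Q⁻¹ := by positivity
  have hA0 : L * Q⁻¹ ≤ A := by
    rw [← div_eq_mul_inv]
    exact div_le_div_of_nonneg_left hL0.le hQ1 (by linarith)
  have hA4 : A ≤ 4 * (L * Q⁻¹) := by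
    rw [← div_eq_mul_inv, ← mul_div_assoc, div_le_div_iff₀ hQ1 hQ0]
    nlinarith
  have hD0 : 0 ≤ D := by positivity
  have hD1 : D ≤ L * Q⁻¹ := by
    rw [← div_eq_mul_inv, div_le_div_iff₀ (by positivity) hQ0]
    nlinarith [mul_pos hL0 hQ0, mul_pos (mul_pos hL0 hQ0) hQ0]
  refine ⟨fun j hj ↦ ?_, ?_, fun hL1 _ ↦ ?_, fun hL1 hx ↦ ?_⟩
  · interval_cases j
    · rw [h0, abs_le]; constructor <;> linarith
    · rw [h1, abs_le]; constructor <;> linarith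
    · rw [h2, abs_le]; constructor <;> linarith
  · -- the three values add up to `3 * L / (Q ^ 3 - 1)`
    have hQ3 : (4 / 3) ^ 3 ≤ Q ^ 3 := by gcongr
    have hQ31 : 0 < Q ^ 3 - 1 := by linarith
    have hsum : A + -D + -D = 3 * L / (Q ^ 3 - 1) := by
      have : Q ^ 3 - 1 = (Q - 1) * (Q ^ 2 + Q + 1) := by ring
      rw [this, hA, hD]
      have : Q ^ 2 + Q + 1 ≠ 0 := by positivity
      field_simp
      ring
    rw [h0, h1, h2, hsum, abs_of_nonneg (by positivity), show (8 * L * Q⁻¹) ^ 2 =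
      64 * L ^ 2 / Q ^ 2 by field_simp; ring, div_le_div_iff₀ hQ31 (by positivity)]
    have hQQ : Q ^ 2 ≤ 2 * (Q ^ 3 - 1) := by nlinarith [sq_nonneg (Q - 1), sq_nonneg Q]
    calc 3 * L * Q ^ 2 ≤ 3 * L * (2 * (Q ^ 3 - 1)) := by gcongr
      _ = 6 * L * (Q ^ 3 - 1) := by ring
      _ ≤ 64 * L ^ 2 * (Q ^ 3 - 1) := by
        have : 6 * L ≤ 64 * L ^ 2 := by nlinarith
        gcongr
  · rw [h0, h1, abs_of_nonneg (by linarith)]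
    have : 0 < Q⁻¹ := by positivity
    nlinarith
  · have hQ2 : 2 ≤ Q := by
      rw [one_div, inv_le_inv₀ hQ0 two_pos] at hx
      exact hx
    have hA2 : A ≤ 2 * (L * Q⁻¹) := by
      rw [← div_eq_mul_inv, ← mul_div_assoc, div_le_div_iff₀ hQ1 hQ0]
      nlinarith
    rw [h0, h1, abs_of_nonneg (by linarith)]
    linarith

end

/-! ### Prime ideals of number fields -/

section

open Filter NumberField

theorem sum_card_absNorm_eq_le (K : Type*) [Field K] [NumberField K] (n : ℕ) :
    ∑ k ∈ Finset.Icc 1 n, Nat.card {I : Ideal (𝓞 K) // Ideal.absNorm I = k} ≤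
      Nat.card {I : Ideal (𝓞 K) // Ideal.absNorm I ≤ n} := by
  rw [← Finset.card_preimage_eq_sum_card_image_eq
    (fun k _ ↦ Ideal.finite_setOfPred_absNorm_eq k)]
  have : Finite {I : Ideal (𝓞 K) // Ideal.absNorm I ≤ n} :=
    Ideal.finite_setOfPred_absNorm_le n
  refine Nat.card_le_card_of_injective
    (fun I ↦ ⟨I.1, ?_⟩) fun I J h ↦ Subtype.ext (by simpa using h)
  have := I.2
  simp only [Set.mem_preimage, Finset.coe_Icc, Set.mem_Icc] at this
  exact this.2

/-- The number of nonzero ideals of norm at most `n` is `O(n)`. -/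
theorem sum_card_absNorm_eq_isBigO (K : Type*) [Field K] [NumberField K] :
    (fun n : ℕ ↦ ∑ k ∈ Finset.Icc 1 n,
      (Nat.card {I : Ideal (𝓞 K) // Ideal.absNorm I = k} : ℝ)) =O[atTop]
        fun n ↦ (n : ℝ) ^ (1 : ℝ) := by
  have h := ((Ideal.tendsto_norm_le_div_atTop K).comp tendsto_natCast_atTop_atTop).isBigO_one ℝ
  have h2 := h.mul (Asymptotics.isBigO_refl (fun n : ℕ ↦ (n : ℝ)) atTop)
  simp only [one_mul] at h2
  simp only [Real.rpow_one]
  refine Asymptotics.IsBigO.trans (Asymptotics.IsBigO.of_bound 1 ?_) h2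
  filter_upwards [eventually_gt_atTop 0] with n hn
  have hn' : (n : ℝ) ≠ 0 := by positivity
  rw [Function.comp_apply, div_mul_cancel₀ _ hn', one_mul,
    Real.norm_of_nonneg (Finset.sum_nonneg fun _ _ ↦ Nat.cast_nonneg _),
    Real.norm_of_nonneg (Nat.cast_nonneg _), ← Nat.cast_sum, Nat.cast_le]
  simp only [Nat.cast_le]
  exact sum_card_absNorm_eq_le K n

theorem summable_absNorm_heightOneSpectrum_rpow (K : Type*) [Field K] [NumberField K] {s : ℝ}
    (hs : 1 < s) :
    Summable fun 𝔭 : IsDedekindDomain.HeightOneSpectrum (𝓞 K) ↦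
      (Ideal.absNorm 𝔭.asIdeal : ℝ) ^ (-s) := by
  have hfin (n : ℕ) : Finite {I : Ideal (𝓞 K) // Ideal.absNorm I = n} :=
    Ideal.finite_setOfPred_absNorm_eq n
  have hL := LSeriesSummable_of_sum_norm_bigO_and_nonneg (sum_card_absNorm_eq_isBigO K)
    (fun _ ↦ Nat.cast_nonneg _) zero_le_one (s := (s : ℂ)) (by simpa using hs)
  have hS : Summable fun n : ℕ ↦
      (Nat.card {I : Ideal (𝓞 K) // Ideal.absNorm I = n} : ℝ) * (n : ℝ) ^ (-s) := by
    refine hL.norm.congr fun n ↦ ?_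
    rcases eq_or_ne n 0 with rfl | hn
    · simp [Real.zero_rpow (show -s ≠ 0 by linarith)]
    · rw [LSeries.norm_term_eq, if_neg hn, Real.rpow_neg (Nat.cast_nonneg _), div_eq_mul_inv]
      simp
  have hsig : Summable fun x : Σ n : ℕ, {I : Ideal (𝓞 K) // Ideal.absNorm I = n} ↦
      (x.1 : ℝ) ^ (-s) := by
    rw [summable_sigma_of_nonneg fun _ ↦ by positivity]
    refine ⟨fun n ↦ Summable.of_finite, hS.congr fun n ↦ ?_⟩
    change _ = ∑' _ : {I : Ideal (𝓞 K) // Ideal.absNorm I = n}, (n : ℝ) ^ (-s)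
    rw [tsum_const, nsmul_eq_mul]
  have hid : Summable fun I : Ideal (𝓞 K) ↦ (Ideal.absNorm I : ℝ) ^ (-s) :=
    (Equiv.sigmaFiberEquiv (fun I : Ideal (𝓞 K) ↦ Ideal.absNorm I)).summable_iff.mp
      (hsig.congr fun x ↦ by
        rw [Function.comp_apply, Equiv.sigmaFiberEquiv_apply, x.2.2])
  exact hid.comp_injective fun 𝔭 𝔮 h ↦ IsDedekindDomain.HeightOneSpectrum.ext h

theorem exists_primeNotThree_of_mod_three_eq_one {p : ℕ} (hp : p.Prime) (hp3 : (p : ZMod 3) = 1) :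
    ∃ 𝔭 : PrimeNotThree, primeNorm 𝔭 = p := by
  have := Fact.mk hp
  have hpd : ¬ p ∣ 3 := fun h ↦ by
    rw [(Nat.prime_dvd_prime_iff_eq hp Nat.prime_three).mp h] at hp3
    exact absurd hp3 (by decide)
  have hspan : (Ideal.span {(p : ℤ)}).IsPrime :=
    (Ideal.span_singleton_prime (by exact_mod_cast hp.ne_zero)).mpr (Nat.prime_iff_prime_int.mp hp)
  have : IsCyclotomicExtension {3} ℚ EisensteinField := CyclotomicField.isCyclotomicExtension 3 ℚ
  obtain ⟨⟨P, hP, hPo⟩⟩ := (Ideal.span {(p : ℤ)}).nonempty_primesOver (S := 𝓞 EisensteinField)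
  have hPo : P.LiesOver (Ideal.span {(p : ℤ)}) := hPo
  have hmax : (Ideal.span {(p : ℤ)}).IsMaximal :=
    hspan.isMaximal (by simpa using hp.ne_zero)
  have hPmax : P.IsMaximal := .of_liesOver_isMaximal P (Ideal.span {(p : ℤ)})
  have hnorm : Ideal.absNorm P = p := by
    rw [Ideal.absNorm_eq_pow_inertiaDeg' P hp, Ideal.inertiaDeg'_eq_inertiaDeg,
      IsCyclotomicExtension.Rat.inertiaDeg_eq_of_not_dvd (m := 3) p EisensteinField P hpd, hp3,
      orderOf_one, pow_one]
  refine ⟨⟨⟨P, hP, fun h ↦ hp.ne_zero ?_⟩, fun h ↦ hP.ne_top ?_⟩, hnorm⟩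
  · rw [← hnorm, h, Ideal.absNorm_bot]
  · have h3 : ((3 : ℕ) : 𝓞 EisensteinField) ∈ P := by
      simpa using Ideal.dvd_span_singleton.mp h
    have hp' : ((p : ℕ) : 𝓞 EisensteinField) ∈ P := by
      have := Ideal.absNorm_mem P
      rwa [hnorm] at this
    have hco : IsCoprime ((p : ℕ) : 𝓞 EisensteinField) ((3 : ℕ) : 𝓞 EisensteinField) :=
      Nat.isCoprime_iff_coprime.mpr ((hp.coprime_iff_not_dvd).mpr hpd) |>.intCast
    obtain ⟨x, y, hxy⟩ := hco
    rw [Ideal.eq_top_iff_one, ← hxy]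
    exact P.add_mem (P.mul_mem_left _ hp') (P.mul_mem_left _ h3)

end

/-! ### The Euler products -/

section

open Filter NumberField

theorem two_le_primeNorm (𝔭 : PrimeNotThree) : 2 ≤ primeNorm 𝔭 := by
  have h0 : primeNorm 𝔭 ≠ 0 := fun h ↦ 𝔭.1.ne_bot (Ideal.absNorm_eq_zero_iff.mp h)
  have h1 : primeNorm 𝔭 ≠ 1 := fun h ↦ 𝔭.1.isPrime.ne_top (Ideal.absNorm_eq_one_iff.mp h)
  omega

theorem four_thirds_le_primeNorm_rpow {σ : ℝ} (hσ : 1 / 2 < σ) (𝔭 : PrimeNotThree) :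
    4 / 3 ≤ (primeNorm 𝔭 : ℝ) ^ σ := by
  have h2 : (2 : ℝ) ≤ primeNorm 𝔭 := by exact_mod_cast two_le_primeNorm 𝔭
  calc (4 / 3 : ℝ) ≤ √2 := Real.le_sqrt_of_sq_le (by norm_num)
    _ = 2 ^ (1 / 2 : ℝ) := Real.sqrt_eq_rpow 2
    _ ≤ 2 ^ σ := Real.rpow_le_rpow_of_exponent_le one_le_two hσ.le
    _ ≤ _ := Real.rpow_le_rpow zero_le_two h2 (by linarith)

theorem half_le_log_primeNorm (𝔭 : PrimeNotThree) : 1 / 2 ≤ Real.log (primeNorm 𝔭) := by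
  have h2 : (2 : ℝ) ≤ primeNorm 𝔭 := by exact_mod_cast two_le_primeNorm 𝔭
  have := Real.log_le_log two_pos h2
  linarith [Real.log_two_gt_d9]

/-- The condition `σ > 1/2` enters here: `(log N(𝔭))² N(𝔭)^(-2σ)` is summable because
`2σ - 2ε > 1` for `ε = (2σ - 1)/4`, and `log N ≤ N^ε / ε`. -/
theorem summable_log_mul_rpow_primeNorm_sq {σ : ℝ} (hσ : 1 / 2 < σ) :
    Summable fun 𝔭 : PrimeNotThree ↦
      (8 * Real.log (primeNorm 𝔭) * ((primeNorm 𝔭 : ℝ) ^ σ)⁻¹) ^ 2 := by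
  set ε := (2 * σ - 1) / 4 with hε
  have hε0 : 0 < ε := by rw [hε]; linarith
  have hs := ((summable_absNorm_heightOneSpectrum_rpow EisensteinField
    (s := 2 * σ - 2 * ε) (by rw [hε]; linarith)).comp_injective
      (Subtype.val_injective (p := fun 𝔭 : IsDedekindDomain.HeightOneSpectrum
        (𝓞 EisensteinField) ↦ ¬ 𝔭.asIdeal ∣ Ideal.span {(3 : 𝓞 EisensteinField)}))).mul_left
          ((8 / ε) ^ 2)
  refine Summable.of_nonneg_of_le (fun _ ↦ sq_nonneg _) (fun 𝔭 ↦ ?_) hs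
  change _ ≤ (8 / ε) ^ 2 * (primeNorm 𝔭 : ℝ) ^ (-(2 * σ - 2 * ε))
  have hN : (0 : ℝ) < primeNorm 𝔭 := by exact_mod_cast zero_lt_two.trans_le (two_le_primeNorm 𝔭)
  have hl := half_le_log_primeNorm 𝔭
  calc (8 * Real.log (primeNorm 𝔭) * ((primeNorm 𝔭 : ℝ) ^ σ)⁻¹) ^ 2
      ≤ (8 * ((primeNorm 𝔭 : ℝ) ^ ε / ε) * ((primeNorm 𝔭 : ℝ) ^ σ)⁻¹) ^ 2 := by
        gcongr
        exact Real.log_le_rpow_div hN.le hε0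
    _ = (8 / ε) ^ 2 * ((primeNorm 𝔭 : ℝ) ^ (ε - σ)) ^ 2 := by
        rw [Real.rpow_sub hN]
        ring
    _ = _ := by
        rw [← Real.rpow_mul_natCast hN.le]
        congr 2
        push_cast
        ring

theorem multipliable_phaseFactor {σ : ℝ} (hσ : 1 / 2 < σ) {a : PrimeNotThree → ℕ → ℝ}
    (ha : ∀ 𝔭, AdmissiblePhases (a 𝔭) (Real.log (primeNorm 𝔭)) ((primeNorm 𝔭 : ℝ) ^ σ)⁻¹)
    (y : ℝ) : Multipliable fun 𝔭 ↦ phaseFactor (primeNorm 𝔭) y (a 𝔭) := by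
  have hs : Summable fun 𝔭 ↦ phaseFactor (primeNorm 𝔭) y (a 𝔭) - 1 :=
    ((summable_log_mul_rpow_primeNorm_sq hσ).mul_left (|y| + 12 * y ^ 2)).of_norm_bounded
      fun 𝔭 ↦ norm_phaseFactor_sub_one_le _ y (ha 𝔭).abs_le (ha 𝔭).abs_sum_le
  simpa using Complex.multipliable_one_add_of_summable hs

theorem norm_tprod_le_prod_norm {ι : Type*} {f : ι → ℂ} (hf : Multipliable f)
    (h1 : ∀ i, ‖f i‖ ≤ 1) (T : Finset ι) : ‖∏' i, f i‖ ≤ ∏ i ∈ T, ‖f i‖ := by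
  classical
  refine le_of_tendsto hf.hasProd.norm ?_
  filter_upwards [eventually_ge_atTop T] with s hs
  rw [← Finset.prod_sdiff hs]
  exact mul_le_of_le_one_left (Finset.prod_nonneg fun _ _ ↦ norm_nonneg _)
    (Finset.prod_le_one (fun _ _ ↦ norm_nonneg _) fun i _ ↦ h1 i)

/-- The degree-one primes alone already give the expected size `X^(1-2σ)`, up to `X^(-η)`, of the
tail of `∑ N(𝔭)^(-2σ)`. -/
theorem exists_primeNotThree_sum_rpow_ge {σ : ℝ} (hσ : 1 / 2 < σ) {η : ℝ} (hη : 0 < η) :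
    ∀ᶠ X : ℝ in atTop, ∃ T : Finset PrimeNotThree, (∀ 𝔭 ∈ T, X ≤ (primeNorm 𝔭 : ℝ)) ∧
      X ^ (1 - 2 * σ - η) ≤ ∑ 𝔭 ∈ T, (primeNorm 𝔭 : ℝ) ^ (-(2 * σ)) := by
  classical
  filter_upwards [exists_primes_sum_rpow_ge (isUnit_one (M := ZMod 3))
    (show 1 < 2 * σ by linarith) hη] with X hX
  obtain ⟨S, hS, hsum⟩ := hX
  choose g hg using fun p : S ↦
    exists_primeNotThree_of_mod_three_eq_one (hS p p.2).1 (hS p p.2).2.1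
  have hinj : Function.Injective g := fun p q h ↦ Subtype.ext <| by rw [← hg p, ← hg q, h]
  refine ⟨Finset.univ.image g, fun 𝔭 h𝔭 ↦ ?_, ?_⟩
  · obtain ⟨p, -, rfl⟩ := Finset.mem_image.mp h𝔭
    rw [hg]
    exact (hS p p.2).2.2
  · rw [Finset.sum_image fun p _ q _ h ↦ hinj h]
    simp only [hg]
    rwa [Finset.univ_eq_attach, Finset.sum_attach S fun p ↦ (p : ℝ) ^ (-(2 * σ))]

/-- For primes of norm beyond `|y|^β` with `β > 1/σ` the phases are small enough that the quadratic
estimate `norm_phaseFactor_le_exp` applies, even with the extra factor `log N` of the logarithmic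
derivative. -/
theorem eventually_two_mul_log_le_rpow {σ β : ℝ} (hβ : 0 < β) (hσβ : 1 < σ * β) :
    ∀ᶠ Y : ℝ in atTop, ∀ Z ≥ Y ^ β, 2 * Y * Real.log Z ≤ Z ^ σ := by
  have hκ : 0 < σ - 1 / β := by rw [sub_pos, div_lt_iff₀ hβ]; exact hσβ
  obtain ⟨M, hM⟩ := eventually_atTop.mp
    ((isLittleO_log_rpow_atTop hκ).bound (show (0 : ℝ) < 1 / 2 by norm_num))
  filter_upwards [(tendsto_rpow_atTop hβ).eventually_ge_atTop M, eventually_ge_atTop 1]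
    with Y hYM hY1 Z hZ
  have hYβ : 1 ≤ Y ^ β := Real.one_le_rpow hY1 hβ.le
  have hZ0 : 0 < Z := by linarith
  have hlog := hM Z (hYM.trans hZ)
  rw [Real.norm_of_nonneg (Real.log_nonneg (hYβ.trans hZ)),
    Real.norm_of_nonneg (Real.rpow_nonneg hZ0.le _)] at hlog
  have hYZ : Y ≤ Z ^ (1 / β) := by
    rw [one_div]
    exact (Real.le_rpow_inv_iff_of_pos (by linarith) hZ0.le hβ).mpr hZ
  calc 2 * Y * Real.log Z ≤ 2 * Z ^ (1 / β) * (1 / 2 * Z ^ (σ - 1 / β)) := by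
        gcongr
        exact Real.log_nonneg (hYβ.trans hZ)
    _ = Z ^ (1 / β) * Z ^ (σ - 1 / β) := by ring
    _ = Z ^ σ := by rw [← Real.rpow_add hZ0, add_sub_cancel]

/-- Decay of an Euler product with admissible phases. All factors have norm at most `1`, so only
those at finitely many primes of norm at least `X = |y|^β`, with `β` slightly above `1/σ`, are kept;
each is at most `exp (-y² N(𝔭)^(-2σ) / 15)`. The threshold `Y` does not depend on the family of
phases. -/
theorem norm_tprod_phaseFactor_le {σ : ℝ} (hσ : 1 / 2 < σ) {δ : ℝ} (hδ : 0 < δ) :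
    ∃ Y : ℝ, ∀ a : PrimeNotThree → ℕ → ℝ,
      (∀ 𝔭, AdmissiblePhases (a 𝔭) (Real.log (primeNorm 𝔭)) ((primeNorm 𝔭 : ℝ) ^ σ)⁻¹) →
      ∀ y : ℝ, Y ≤ |y| → ‖∏' 𝔭, phaseFactor (primeNorm 𝔭) y (a 𝔭)‖ ≤
        Real.exp (-(1 / 15) * |y| ^ (1 / σ - δ)) := by
  have hσ0 : 0 < σ := by linarith
  obtain ⟨η, hη0, hη1, hη⟩ : ∃ η : ℝ, 0 < η ∧ η ≤ 1 ∧ η * (2 * σ) ≤ δ / 2 := by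
    refine ⟨min 1 (δ / (4 * σ)), by positivity, min_le_left _ _, ?_⟩
    calc _ ≤ δ / (4 * σ) * (2 * σ) := by gcongr; exact min_le_right _ _
      _ = δ / 2 := by field_simp; ring
  -- `η` is the excess of `β` over `1 / σ`, and `η'` the loss in the tail of `∑ N(𝔭)^(-2σ)`;
  -- together they cost at most `δ` in the exponent
  set η' := δ / 2 / (1 / σ + 1) with hη'
  have hη'0 : 0 < η' := by positivity
  have hη'1 : η' * (1 / σ + 1) = δ / 2 := div_mul_cancel₀ _ (by positivity)
  set β := 1 / σ + η with hβ
  have hβ0 : 0 < β := by positivity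
  have hσβ : σ * β = 1 + σ * η := by rw [hβ]; field_simp
  have hexp : 1 / σ - δ ≤ 2 + β * (1 - 2 * σ - η') := by
    have e : 2 + β * (1 - 2 * σ - η') = 1 / σ + η - η * (2 * σ) - η' * (1 / σ + η) := by
      linear_combination -2 * hσβ + (1 - η') * hβ
    have : η' * (1 / σ + η) ≤ η' * (1 / σ + 1) := by gcongr
    linarith
  obtain ⟨Y, hY⟩ := eventually_atTop.mp <|
    ((tendsto_rpow_atTop hβ0).eventually (exists_primeNotThree_sum_rpow_ge hσ hη'0)).and <|
    (eventually_two_mul_log_le_rpow hβ0 (by rw [hσβ]; linarith [mul_pos hσ0 hη0])).and <|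
    ((tendsto_rpow_atTop hβ0).eventually_ge_atTop 3).and (eventually_ge_atTop 1)
  refine ⟨Y, fun a ha y hy ↦ ?_⟩
  obtain ⟨⟨T, hT, hsum⟩, hlog, h3, hy1⟩ := hY |y| hy
  have hy0 : 0 < |y| := by linarith
  have hfac (𝔭 : PrimeNotThree) (h𝔭 : 𝔭 ∈ T) : ‖phaseFactor (primeNorm 𝔭) y (a 𝔭)‖ ≤
      Real.exp (-(1 / 15) * (y ^ 2 * (primeNorm 𝔭 : ℝ) ^ (-(2 * σ)))) := by
    have hN := hT 𝔭 h𝔭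
    have hN0 : (0 : ℝ) < primeNorm 𝔭 := by linarith
    have hQ := hlog _ hN
    set Q := (primeNorm 𝔭 : ℝ) ^ σ with hQdef
    have hQ0 : 0 < Q := by positivity
    have hL : 1 ≤ Real.log (primeNorm 𝔭) := by
      rw [Real.le_log_iff_exp_le hN0]
      linarith [Real.exp_one_lt_d9]
    have hx : Q⁻¹ ≤ 1 / 2 := by
      rw [one_div, inv_le_inv₀ hQ0 two_pos]
      nlinarith
    have hlow := (ha 𝔭).le_abs_sub hL hx
    have hupp := (ha 𝔭).abs_sub_le hL hx
    refine (norm_phaseFactor_le_exp (one_le_two.trans (two_le_primeNorm 𝔭)) ?_).trans ?_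
    · rw [abs_mul]
      calc |y| * |a 𝔭 0 - a 𝔭 1| ≤ |y| * (3 * Real.log (primeNorm 𝔭) * Q⁻¹) := by gcongr
        _ = 3 / 2 * ((2 * |y| * Real.log (primeNorm 𝔭)) * Q⁻¹) := by ring
        _ ≤ 3 / 2 * (Q * Q⁻¹) := by gcongr
        _ = 3 / 2 := by rw [mul_inv_cancel₀ hQ0.ne', mul_one]
    · have hsq : (primeNorm 𝔭 : ℝ) ^ (-(2 * σ)) ≤ (a 𝔭 0 - a 𝔭 1) ^ 2 := by
        rw [Real.rpow_neg hN0.le, mul_comm, Real.rpow_mul hN0.le, Real.rpow_two, ← inv_pow,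
          ← sq_abs (a 𝔭 0 - a 𝔭 1)]
        gcongr
      have := mul_le_mul_of_nonneg_left hsq (sq_nonneg y)
      rw [Real.exp_le_exp, mul_pow]
      linarith
  have hpow : |y| ^ (1 / σ - δ) ≤ y ^ 2 * ∑ 𝔭 ∈ T, (primeNorm 𝔭 : ℝ) ^ (-(2 * σ)) :=
    calc |y| ^ (1 / σ - δ) ≤ |y| ^ (2 + β * (1 - 2 * σ - η')) :=
          Real.rpow_le_rpow_of_exponent_le hy1 hexp
      _ = y ^ 2 * (|y| ^ β) ^ (1 - 2 * σ - η') := by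
          rw [Real.rpow_add hy0, Real.rpow_mul hy0.le, Real.rpow_two, sq_abs]
      _ ≤ _ := by gcongr
  calc ‖∏' 𝔭, phaseFactor (primeNorm 𝔭) y (a 𝔭)‖
      ≤ ∏ 𝔭 ∈ T, ‖phaseFactor (primeNorm 𝔭) y (a 𝔭)‖ :=
        norm_tprod_le_prod_norm (multipliable_phaseFactor hσ ha y)
          (fun 𝔭 ↦ norm_phaseFactor_le_one _ _ _) T
    _ ≤ ∏ 𝔭 ∈ T, Real.exp (-(1 / 15) * (y ^ 2 * (primeNorm 𝔭 : ℝ) ^ (-(2 * σ)))) :=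
        Finset.prod_le_prod (fun _ _ ↦ norm_nonneg _) hfac
    _ = Real.exp (-(1 / 15) * (y ^ 2 * ∑ 𝔭 ∈ T, (primeNorm 𝔭 : ℝ) ^ (-(2 * σ)))) := by
        rw [← Real.exp_sum, Finset.mul_sum, Finset.mul_sum]
    _ ≤ Real.exp (-(1 / 15) * |y| ^ (1 / σ - δ)) := by
        rw [Real.exp_le_exp]
        linarith

end

end CubicEuler

theorem mainTheorem6 (σ : ℝ) (hσ : 1 / 2 < σ) (δ : ℝ) (hδ : 0 < δ) :
    (∀ y : ℝ, Multipliable (fun 𝔭 : CubicEuler.PrimeNotThree => CubicEuler.factorLog σ y 𝔭)) ∧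
    (∀ y : ℝ, Multipliable (fun 𝔭 : CubicEuler.PrimeNotThree => CubicEuler.factorLogDeriv σ y 𝔭)) ∧
    ∃ C : ℝ, 0 < C ∧ ∃ Y : ℝ, ∀ y : ℝ, Y ≤ |y| →
      ‖CubicEuler.MtildeLog σ y‖ ≤ Real.exp (-C * |y| ^ (1 / σ - δ)) ∧
      ‖CubicEuler.MtildeLogDeriv σ y‖ ≤ Real.exp (-C * |y| ^ (1 / σ - δ)) := by
  have h1 (𝔭 : CubicEuler.PrimeNotThree) := CubicEuler.admissiblePhases_log
    (CubicEuler.four_thirds_le_primeNorm_rpow hσ 𝔭) (CubicEuler.half_le_log_primeNorm 𝔭)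
  have h2 (𝔭 : CubicEuler.PrimeNotThree) := CubicEuler.admissiblePhases_logDeriv
    (CubicEuler.four_thirds_le_primeNorm_rpow hσ 𝔭) (CubicEuler.half_le_log_primeNorm 𝔭)
  obtain ⟨Y, hY⟩ := CubicEuler.norm_tprod_phaseFactor_le hσ hδ
  refine ⟨CubicEuler.multipliable_phaseFactor hσ h1, CubicEuler.multipliable_phaseFactor hσ h2,
    1 / 15, by norm_num, Y, fun y hy ↦ ⟨?_, ?_⟩⟩
  · rw [CubicEuler.MtildeLog, norm_mul, CubicEuler.norm_exp_neg_two_I_mul, one_mul]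
    exact hY _ h1 y hy
  · rw [CubicEuler.MtildeLogDeriv, norm_mul, CubicEuler.norm_exp_neg_two_I_mul, one_mul]
    exact hY _ h2 y hy
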